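/- Let $\mathcal Q$ be any (finite or infinite, possibly empty) set of primes. Let $\mathbb A_{\mathcal Q}$ be the set of all $(x_\infty,(x_p)_{p\in\mathcal Q})\in\mathbb R\times\prod_{p\in\mathcal Q}\mathbb Q_p$ with $x_p\in\mathbb Z_p$ for all but finitely many $p$, with componentwise addition and the restricted product topology with respect to the $\mathbb Z_p$. Let $\Gamma_{\mathcal Q}=\mathbb Z[1/p:p\in\mathcal Q]\subseteq\mathbb Q$, embedded in $\mathbb A_{\mathcal Q}$ by $\gamma\mapsto(\gamma,\gamma,\gamma,\dots)$, and let $X_{\mathcal Q}=\mathbb A_{\mathcal Q}/\Gamma_{\mathcal Q}$, a compact abelian group with Haar probability measure $|\cdot|$. For $\alpha\in X_{\mathcal Q}$, a finite family $A=(A_1,\dots,A_k)$, $k\ge 0$, of measurable subsets of $X_{\mathcal Q}$ (a multiset), with $\chi_A=\sum_i\chi_{A_i}$ and volume $|A|=\sum_i|A_i|$, is called a bounded remainder set for the rotation $x\mapsto x+\alpha$ if there is a constant $C=C(A)>0$ such that, for almost every $x\in X_{\mathcal Q}$ and every $N\in\mathbb N$, $$\Bigl|\sum_{n=0}^{N-1}\chi_A(x+n\alpha)-N|A|\Bigr|\le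 C.$$ For $x=\sum_{i\ge -N}b_ip^i\in\mathbb Q_p$ with digits $b_i\in\{0,\dots,p-1\}$ and $N\ge 0$, let $\{x\}_p=\sum_{-N\le i<0}b_ip^i\in\mathbb Q$ be its $p$-adic fractional part. **Theorem.** Let $\alpha\in X_{\mathcal Q}$ be the class of $(\alpha_\infty,(\alpha_p)_{p\in\mathcal Q})\in\mathbb A_{\mathcal Q}$, and suppose that $\alpha_\infty$ is irrational. Then the set of all volumes $|A|$ of bounded remainder sets $A$ (multisets allowed) for the rotation $x\mapsto x+\alpha$ of $X_{\mathcal Q}$ is exactly the set of those real numbers $$-\gamma\alpha_\infty+\sum_{p\in\mathcal Q}\{\gamma\alpha_p\}_p+n,\qquad \gamma\in\Gamma_{\mathcal Q},\ n\in\mathbb Z,$$ that are $\ge 0$. -/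

import Mathlib

open MeasureTheory RestrictedProduct

noncomputable section

namespace AdelicBRS

/-! ### The `p`-adic fractional part -/

/-- The least `N ≥ 0` such that `p ^ N * x` is a `p`-adic integer. -/
def padicPole (p : ℕ) [Fact p.Prime] (x : ℚ_[p]) : ℕ := (-x.valuation).toNat

theorem norm_padicPole_mul_le (p : ℕ) [hp : Fact p.Prime] (x : ℚ_[p]) :
    ‖(p : ℚ_[p]) ^ padicPole p x * x‖ ≤ 1 := by
  rcases eq_or_ne x 0 with rfl | hx
  · simp
  have hp0 : (p : ℚ_[p]) ≠ 0 := by exact_mod_cast hp.out.ne_zero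
  rw [Padic.norm_le_one_iff_val_nonneg, Padic.valuation_mul (pow_ne_zero _ hp0) hx,
    Padic.valuation_pow, Padic.valuation_p, padicPole]
  omega

/-- The `p`-adic fractional part `{x}_p`: if `x = ∑_{i ≥ -N} b_i p^i` with digits
`0 ≤ b_i < p`, this is the rational number `∑_{-N ≤ i < 0} b_i p^i`.  Indeed `p ^ N * x` has the
digit expansion `∑_{i ≥ 0} b_{i-N} p^i`, and `PadicInt.appr y N` is the sum of the first `N` terms
of the digit expansion of `y`, i.e. the only natural number below `p ^ N` congruent to `y`
modulo `p ^ N`. -/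
def padicFract (p : ℕ) [Fact p.Prime] (x : ℚ_[p]) : ℚ :=
  (PadicInt.appr ⟨(p : ℚ_[p]) ^ padicPole p x * x, norm_padicPole_mul_le p x⟩ (padicPole p x) : ℚ)
    / (p : ℚ) ^ padicPole p x

theorem padicFract_nonneg (p : ℕ) [Fact p.Prime] (x : ℚ_[p]) : 0 ≤ padicFract p x := by
  unfold padicFract; positivity

theorem padicFract_lt_one (p : ℕ) [hp : Fact p.Prime] (x : ℚ_[p]) : padicFract p x < 1 := by
  have hp0 : (0 : ℚ) < p := by exact_mod_cast hp.out.pos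
  unfold padicFract
  rw [div_lt_one (by positivity)]
  exact_mod_cast PadicInt.appr_lt _ _

theorem norm_sub_padicFract_le (p : ℕ) [hp : Fact p.Prime] (x : ℚ_[p]) :
    ‖x - (padicFract p x : ℚ_[p])‖ ≤ 1 := by
  have hp0 : (p : ℚ_[p]) ≠ 0 := by exact_mod_cast hp.out.ne_zero
  obtain ⟨c, hc⟩ := Ideal.mem_span_singleton'.mp (PadicInt.appr_spec (padicPole p x)
    ⟨(p : ℚ_[p]) ^ padicPole p x * x, norm_padicPole_mul_le p x⟩)
  have hc' : (c : ℚ_[p]) * (p : ℚ_[p]) ^ padicPole p x = (p : ℚ_[p]) ^ padicPole p x * x -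
      (PadicInt.appr ⟨(p : ℚ_[p]) ^ padicPole p x * x, norm_padicPole_mul_le p x⟩
        (padicPole p x) : ℚ_[p]) := by
    have h := congrArg (fun z : ℤ_[p] => (z : ℚ_[p])) hc
    have h2 (y : ℤ_[p]) (n : ℕ) : ((y - n : ℤ_[p]) : ℚ_[p]) = (y : ℚ_[p]) - (n : ℚ_[p]) := by simp
    simpa only [PadicInt.coe_mul, PadicInt.coe_pow, PadicInt.coe_natCast] using h.trans (h2 _ _)
  have : x - (padicFract p x : ℚ_[p]) = c := by
    have hpN : (p : ℚ_[p]) ^ padicPole p x ≠ 0 := pow_ne_zero _ hp0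
    unfold padicFract
    push_cast
    generalize (PadicInt.appr ⟨(p : ℚ_[p]) ^ padicPole p x * x, norm_padicPole_mul_le p x⟩
        (padicPole p x) : ℚ_[p]) = a at hc' ⊢
    field_simp
    linear_combination -hc'
  rw [this]
  exact c.2

theorem padicFract_eq_zero (p : ℕ) [Fact p.Prime] {x : ℚ_[p]} (hx : ‖x‖ ≤ 1) :
    padicFract p x = 0 := by
  have h0 : padicPole p x = 0 := by
    have := (Padic.norm_le_one_iff_val_nonneg x).mp hx
    unfold padicPole; omega
  unfold padicFract
  have := PadicInt.appr_lt ⟨(p : ℚ_[p]) ^ padicPole p x * x, norm_padicPole_mul_le p x⟩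
    (padicPole p x)
  rw [show p ^ padicPole p x = 1 by rw [h0, pow_zero], Nat.lt_one_iff] at this
  rw [this]; simp

/-! ### The adele ring `𝔸_Q`, the group `Γ_Q` and the solenoid `X_Q` -/

instance factPrime {Q : Set Nat.Primes} (p : Q) : Fact (Nat.Prime (p : Nat.Primes)) := ⟨p.1.2⟩

instance factIsOpen (Q : Set Nat.Primes) :
    Fact (∀ p : Q, IsOpen (PadicInt.subring (p : Nat.Primes) : Set ℚ_[(p : Nat.Primes)])) :=
  ⟨fun p => by
    have : (PadicInt.subring (p : Nat.Primes) : Set ℚ_[(p : Nat.Primes)])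
        = Metric.closedBall 0 1 := by
      ext x; simp [PadicInt.mem_subring_iff]
    rw [this]
    exact IsUltrametricDist.isOpen_closedBall 0 one_ne_zero⟩

/-- `𝔸_Q`: the product of `ℝ` and the restricted product of the `ℚ_p`, `p ∈ Q`, with respect to
the rings `ℤ_p`, with its ring structure and its restricted product topology. -/
abbrev Adele (Q : Set Nat.Primes) : Type :=
  ℝ × Πʳ p : Q, [ℚ_[(p : Nat.Primes)], (PadicInt.subring (p : Nat.Primes))]

/-- `Γ_Q = ℤ[1/p : p ∈ Q]`, a subring of `ℚ`. -/
def Gam (Q : Set Nat.Primes) : Subring ℚ :=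
  Subring.closure {x : ℚ | ∃ p ∈ Q, x = 1 / ((p : ℕ) : ℚ)}

theorem finite_not_integral (Q : Set Nat.Primes) (γ : ℚ) :
    {p : Q | ¬ (γ : ℚ_[(p : Nat.Primes)]) ∈ PadicInt.subring (p : Nat.Primes)}.Finite := by
  have hf : {n : ℕ | n ∣ γ.den}.Finite :=
    (Nat.divisors γ.den).finite_toSet.subset fun n hn => by simpa [γ.den_nz] using hn
  have hi : Function.Injective fun p : Q => ((p : Nat.Primes) : ℕ) := fun a b h =>
    Subtype.ext (Subtype.ext h)
  refine (hf.preimage hi.injOn).subset fun p hp => ?_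
  by_contra h
  exact hp ((PadicInt.mem_subring_iff _).mpr (Padic.norm_rat_le_one h))

/-- The diagonal embedding `γ ↦ (γ, γ, γ, …)` of `ℚ` into `𝔸_Q`. -/
def diag (Q : Set Nat.Primes) : ℚ →+* Adele Q where
  toFun γ := ((γ : ℝ), ⟨fun p => (γ : ℚ_[(p : Nat.Primes)]), finite_not_integral Q γ⟩)
  map_one' := by ext <;> simp
  map_mul' a b := Prod.ext (by simp) (RestrictedProduct.ext _ _ fun p => Rat.cast_mul a b)
  map_zero' := by ext <;> simp
  map_add' a b := Prod.ext (by simp) (RestrictedProduct.ext _ _ fun p => Rat.cast_add a b)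

/-- The image of `Γ_Q` in `𝔸_Q` under the diagonal embedding, as an additive subgroup. -/
def lattice (Q : Set Nat.Primes) : AddSubgroup (Adele Q) :=
  (Gam Q).toAddSubgroup.map (diag Q).toAddMonoidHom

/-- The solenoid `X_Q = 𝔸_Q / Γ_Q`, an additive topological group with the quotient topology. -/
def Solenoid (Q : Set Nat.Primes) : Type := Adele Q ⧸ lattice Q

instance (Q : Set Nat.Primes) : AddCommGroup (Solenoid Q) :=
  inferInstanceAs (AddCommGroup (Adele Q ⧸ lattice Q))

instance (Q : Set Nat.Primes) : TopologicalSpace (Solenoid Q) :=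
  inferInstanceAs (TopologicalSpace (Adele Q ⧸ lattice Q))

instance (Q : Set Nat.Primes) : IsTopologicalAddGroup (Solenoid Q) :=
  inferInstanceAs (IsTopologicalAddGroup (Adele Q ⧸ lattice Q))

/-- `X_Q` carries its Borel σ-algebra. -/
instance (Q : Set Nat.Primes) : MeasurableSpace (Solenoid Q) := borel _

instance (Q : Set Nat.Primes) : BorelSpace (Solenoid Q) := ⟨rfl⟩

/-- The canonical projection `𝔸_Q → X_Q`. -/
def proj (Q : Set Nat.Primes) : Adele Q →+ Solenoid Q := QuotientAddGroup.mk' (lattice Q)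

theorem continuous_proj (Q : Set Nat.Primes) : Continuous (proj Q) := continuous_quot_mk

theorem finite_padicFract_ne_zero (Q : Set Nat.Primes) (x : Adele Q) :
    {p : Q | padicFract (p : Nat.Primes) (x.2 p) ≠ 0}.Finite :=
  Set.Finite.subset x.2.2 fun _ hp h => hp (padicFract_eq_zero _ h)

theorem padicFract_mem_Gam (Q : Set Nat.Primes) (p : Q) (x : ℚ_[(p : Nat.Primes)]) :
    padicFract (p : Nat.Primes) x ∈ Gam Q := by
  have : (1 / (((p : Nat.Primes) : ℕ) : ℚ)) ∈ Gam Q :=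
    Subring.subset_closure ⟨p, p.2, rfl⟩
  unfold padicFract
  rw [div_eq_mul_one_div, ← one_div_pow]
  exact (Gam Q).mul_mem (natCast_mem _ _) ((Gam Q).pow_mem this _)

theorem norm_padicFract_le_of_ne (Q : Set Nat.Primes) {p q : Q} (hpq : p ≠ q)
    (x : ℚ_[(p : Nat.Primes)]) :
    ‖(padicFract (p : Nat.Primes) x : ℚ_[(q : Nat.Primes)])‖ ≤ 1 := by
  have hco : Nat.Coprime (q : Nat.Primes) (p : Nat.Primes) :=
    (Nat.coprime_primes q.1.2 p.1.2).mpr fun h => hpq (Subtype.ext (Subtype.ext h.symm))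
  unfold padicFract
  push_cast
  rw [norm_div, norm_pow, (Padic.norm_natCast_eq_one_iff).mpr hco, one_pow, div_one]
  exact_mod_cast Padic.norm_int_le_one _

/-- Every adele is congruent modulo `Γ_Q` to a point of `[0,1] × ∏ ℤ_p`. -/
theorem exists_reduced (Q : Set Nat.Primes) (x : Adele Q) :
    ∃ γ ∈ Gam Q, (x - diag Q γ).1 ∈ Set.Icc (0 : ℝ) 1 ∧
      ∀ p : Q, (x - diag Q γ).2 p ∈ PadicInt.subring (p : Nat.Primes) := by
  classical
  let s := (finite_padicFract_ne_zero Q x).toFinset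
  let γ₀ : ℚ := ∑ p ∈ s, padicFract (p : Nat.Primes) (x.2 p)
  have hγ₀ : γ₀ ∈ Gam Q := sum_mem fun p _ => padicFract_mem_Gam Q p _
  refine ⟨γ₀ + (⌊x.1 - γ₀⌋ : ℤ), add_mem hγ₀ (intCast_mem _ _), ?_, fun q => ?_⟩
  · have h1 := Int.floor_le (x.1 - (γ₀ : ℝ))
    have h2 := Int.lt_floor_add_one (x.1 - (γ₀ : ℝ))
    simp only [Prod.fst_sub, diag, RingHom.coe_mk, MonoidHom.coe_mk, OneHom.coe_mk, Set.mem_Icc]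
    push_cast
    constructor <;> linarith
  · change x.2 q - ((γ₀ + (⌊x.1 - γ₀⌋ : ℤ) : ℚ) : ℚ_[(q : Nat.Primes)]) ∈ _
    rw [Rat.cast_add, ← sub_sub, Rat.cast_intCast]
    refine sub_mem ?_ (intCast_mem _ _)
    have hsum : γ₀ = padicFract (q : Nat.Primes) (x.2 q)
        + ∑ p ∈ s.erase q, padicFract (p : Nat.Primes) (x.2 p) := by
      by_cases hq : q ∈ s
      · exact (Finset.add_sum_erase s (fun p : Q => padicFract (p : Nat.Primes) (x.2 p)) hq).symm
      · have h0 : padicFract (q : Nat.Primes) (x.2 q) = 0 := by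
          by_contra h; exact hq (by simpa [s] using h)
        rw [Finset.erase_eq_of_notMem hq, h0, zero_add]
    rw [hsum, Rat.cast_add, ← sub_sub]
    refine sub_mem ((PadicInt.mem_subring_iff _).mpr (norm_sub_padicFract_le _ _)) ?_
    rw [Rat.cast_sum]
    exact sum_mem fun p hp => (PadicInt.mem_subring_iff _).mpr
      (norm_padicFract_le_of_ne Q (Finset.ne_of_mem_erase hp) _)

instance compactSpace_solenoid (Q : Set Nat.Primes) : CompactSpace (Solenoid Q) := by
  have (p : Q) : CompactSpace (PadicInt.subring (p : Nat.Primes)) :=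
    inferInstanceAs (CompactSpace ℤ_[(p : Nat.Primes)])
  let f : Set.Icc (0 : ℝ) 1 × (∀ p : Q, PadicInt.subring (p : Nat.Primes)) → Solenoid Q :=
    fun z => proj Q ((z.1 : ℝ), structureMap _ _ _ z.2)
  have hf : Continuous f := (continuous_proj Q).comp
    ((continuous_subtype_val.comp continuous_fst).prodMk
      (isEmbedding_structureMap.continuous.comp continuous_snd))
  have hs : Function.Surjective f := by
    intro y
    obtain ⟨x, rfl⟩ := QuotientAddGroup.mk'_surjective (lattice Q) y
    obtain ⟨γ, hγ, h1, h2⟩ := exists_reduced Q x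
    refine ⟨(⟨_, h1⟩, fun p => ⟨_, h2 p⟩), ?_⟩
    refine (QuotientAddGroup.eq (s := lattice Q)).mpr ⟨γ, hγ, ?_⟩
    change diag Q γ = -(x - diag Q γ) + x
    abel
  exact hs.compactSpace hf

/-- The Haar probability measure on the compact group `X_Q`: the Haar measure normalised so that
the whole space has measure `1`. -/
def haar (Q : Set Nat.Primes) : Measure (Solenoid Q) := Measure.addHaarMeasure ⊤

instance (Q : Set Nat.Primes) : (haar Q).IsAddHaarMeasure :=
  inferInstanceAs
    (Measure.addHaarMeasure (⊤ : TopologicalSpace.PositiveCompacts (Solenoid Q))).IsAddHaarMeasure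

instance (Q : Set Nat.Primes) : IsProbabilityMeasure (haar Q) :=
  ⟨Measure.addHaarMeasure_self (K₀ := (⊤ : TopologicalSpace.PositiveCompacts (Solenoid Q)))⟩

/-! ### Bounded remainder sets -/

section BRS

variable {G : Type*} [AddCommGroup G] [MeasurableSpace G]

/-- The characteristic function of the multiset given by the finite family of sets
`A 0, …, A (k - 1)`, that is, the sum of their indicator functions. -/
def multiIndicator {k : ℕ} (A : Fin k → Set G) (x : G) : ℝ :=
  ∑ i, (A i).indicator (fun _ => (1 : ℝ)) x

/-- The volume of a multiset: the sum of the measures of the sets it is made of. -/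
def multiVolume (μ : Measure G) {k : ℕ} (A : Fin k → Set G) : ℝ := ∑ i, μ.real (A i)

/-- The multiset `A` (a finite family of measurable sets) is a bounded remainder set for the
rotation `x ↦ x + α`: there is `C > 0` such that for almost every `x` and all `N`,
`|∑_{n < N} χ_A (x + n α) - N |A|| ≤ C`. -/
def IsBRS (μ : Measure G) (α : G) {k : ℕ} (A : Fin k → Set G) : Prop :=
  (∀ i, MeasurableSet (A i)) ∧
    ∃ C : ℝ, 0 < C ∧ ∀ᵐ x ∂μ, ∀ N : ℕ,
      |∑ n ∈ Finset.range N, multiIndicator A (x + n • α) - N * multiVolume μ A| ≤ C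

/-- The set of all volumes of bounded remainder sets (multisets allowed) for `x ↦ x + α`. -/
def brsVolumes (μ : Measure G) (α : G) : Set ℝ :=
  {v | ∃ (k : ℕ) (A : Fin k → Set G), IsBRS μ α A ∧ v = multiVolume μ A}

end BRS

end AdelicBRS

end

/-! Write `T x = x + α`. If `A` is a bounded remainder set of volume `v`, the upper limit `g` of
the Birkhoff sums of `χ_A - v` satisfies `g ∘ T = g - (χ_A - v)`, and since `χ_A` is
integer-valued, `e^{2πig}` is an eigenfunction of `T` with eigenvalue `e^{2πiv}`. Conversely, if
`θ : G → ℝ / ℤ` satisfies `θ ∘ T = θ + v` with `v ≥ 0`, and `g` is the representative of `θ` in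
`[0, 1)`, then `v + g - g ∘ T` takes values in `ℕ`; its superlevel sets form a multiset of volume
`v` whose Birkhoff sums telescope.

On a compact group the characters in a point-separating subgroup of the dual are complete in `L²`
(Stone–Weierstrass), so an eigenfunction has a nonzero Fourier coefficient at one of them, and its
eigenvalue is a value of that character or its inverse at `α`. On `X_Q` the characters
`x ↦ -γ x_∞ + ∑ {γ x_p}_p`, `γ ∈ Γ_Q`, separate points: if all of them vanish at the class of `x`,
the case `γ = 1` lets us assume `x_∞ = 0`, and then `γ = p^{-k}` forces `p^{-k} x_p ∈ ℤ_p` for all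
`k`, so that `x_p = 0`. -/

open scoped Topology

noncomputable section

namespace AdelicBRS

theorem coe_unitAddCircle_eq_coe_iff {a b : ℝ} :
    (a : UnitAddCircle) = b ↔ ∃ n : ℤ, a = b + n := by
  rw [← sub_eq_zero, ← AddCircle.coe_sub, AddCircle.coe_eq_zero_iff]
  exact exists_congr fun n => by rw [zsmul_one, eq_comm, sub_eq_iff_eq_add']

/-! ### Volumes of bounded remainder sets and eigenfunctions -/

theorem limsup_birkhoffSum_apply {X : Type*} {T : X → X} {f : X → ℝ} {x : X} {C : ℝ}
    (h : ∀ N, |birkhoffSum T f N x| ≤ C) :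
    Filter.limsup (birkhoffSum T f · (T x)) Filter.atTop =
      Filter.limsup (birkhoffSum T f · x) Filter.atTop - f x := by
  have hshift : (birkhoffSum T f · (T x)) = fun N => birkhoffSum T f (N + 1) x + -f x := by
    funext N
    rw [birkhoffSum_succ', add_neg_cancel_comm]
  have hle : Filter.IsBoundedUnder (· ≤ ·) Filter.atTop fun N => birkhoffSum T f (N + 1) x :=
    Filter.isBoundedUnder_of ⟨C, fun N => (abs_le.mp (h _)).2⟩
  have hge : Filter.IsBoundedUnder (· ≥ ·) Filter.atTop fun N => birkhoffSum T f (N + 1) x :=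
    Filter.isBoundedUnder_of ⟨-C, fun N => (abs_le.mp (h _)).1⟩
  rw [hshift, limsup_add_const _ _ _ hle hge.isCoboundedUnder_le,
    Filter.limsup_nat_add (birkhoffSum T f · x), sub_eq_add_neg]

section MultiIndicator

variable {G : Type*} {k : ℕ}

theorem exists_nat_multiIndicator_eq (A : Fin k → Set G) (x : G) :
    ∃ m : ℕ, multiIndicator A x = m := by
  classical
  exact ⟨∑ i, if x ∈ A i then 1 else 0, by simp [multiIndicator, Set.indicator_apply]⟩

theorem multiIndicator_superlevel {F : G → ℕ} {x : G} (hF : F x ≤ k) :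
    multiIndicator (fun i : Fin k => {y | (i : ℕ) < F y}) x = F x := by
  have hfilter : (Finset.range k).filter (· < F x) = Finset.range (F x) := by
    ext i
    simp only [Finset.mem_filter, Finset.mem_range]
    omega
  calc multiIndicator (fun i : Fin k => {y | (i : ℕ) < F y}) x
      = ∑ i : Fin k, if (i : ℕ) < F x then (1 : ℝ) else 0 := by
        simp [multiIndicator, Set.indicator_apply]
    _ = F x := by
        rw [Fin.sum_univ_eq_sum_range (fun i => if i < F x then (1 : ℝ) else 0),
          Finset.sum_boole, hfilter, Finset.card_range]

variable [MeasurableSpace G] {A : Fin k → Set G}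

theorem measurable_multiIndicator (hA : ∀ i, MeasurableSet (A i)) :
    Measurable (multiIndicator A) :=
  Finset.measurable_sum _ fun i _ => measurable_const.indicator (hA i)

theorem integral_multiIndicator (μ : Measure G) [IsFiniteMeasure μ]
    (hA : ∀ i, MeasurableSet (A i)) : ∫ x, multiIndicator A x ∂μ = multiVolume μ A := by
  simp only [multiIndicator, multiVolume]
  rw [integral_finsetSum _ fun i _ => (integrable_const 1).indicator (hA i)]
  exact Finset.sum_congr rfl fun i _ => integral_indicator_one (hA i)

theorem multiVolume_nonneg (μ : Measure G) (A : Fin k → Set G) : 0 ≤ multiVolume μ A :=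
  Finset.sum_nonneg fun _ _ => measureReal_nonneg

end MultiIndicator

section Rotation

variable {G : Type*} [AddCommGroup G] [MeasurableSpace G] [MeasurableAdd G] {μ : Measure G}
  {α : G} {v : ℝ}

theorem exists_eigenfunction_of_mem_brsVolumes (hv : v ∈ brsVolumes μ α) :
    ∃ θ : G → UnitAddCircle, Measurable θ ∧ ∀ᵐ x ∂μ, θ (x + α) = θ x + v := by
  obtain ⟨k, A, ⟨hA, C, -, hC⟩, rfl⟩ := hv
  let f : G → ℝ := fun x => multiIndicator A x - multiVolume μ A
  have hsum (N : ℕ) (x : G) : birkhoffSum (· + α) f N x =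
      ∑ n ∈ Finset.range N, f (x + n • α) := by
    simp only [birkhoffSum, add_right_iterate]
  let g : G → ℝ := fun x => Filter.limsup (birkhoffSum (· + α) f · x) Filter.atTop
  have hf : Measurable f := (measurable_multiIndicator hA).sub_const _
  have hg : Measurable g := Measurable.limsup fun N => by
    rw [funext (hsum N)]
    exact Finset.measurable_sum _ fun n _ => hf.comp (measurable_add_const (n • α))
  refine ⟨fun x => (g x : UnitAddCircle), AddCircle.measurable_mk'.comp hg, ?_⟩
  filter_upwards [hC] with x hx
  have hcob : g (x + α) = g x - f x := limsup_birkhoffSum_apply (T := (· + α)) (C := C) fun N => by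
    simpa [hsum, f, Finset.sum_sub_distrib] using hx N
  obtain ⟨m, hm⟩ := exists_nat_multiIndicator_eq A x
  rw [← AddCircle.coe_add, coe_unitAddCircle_eq_coe_iff]
  refine ⟨-m, ?_⟩
  rw [hcob, Int.cast_neg, Int.cast_natCast, ← hm]
  ring

variable [IsProbabilityMeasure μ] [μ.IsAddRightInvariant]

theorem mem_brsVolumes_of_coboundary {g : G → ℝ} (hg : Measurable g) {B : ℝ}
    (hB : ∀ x, |g x| ≤ B) (hint : ∀ x, ∃ m : ℕ, v + g x - g (x + α) = m) :
    v ∈ brsVolumes μ α := by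
  choose F hF using hint
  have hFmeas : Measurable F := by
    have hgα : Measurable fun x => g (x + α) := hg.comp (measurable_add_const α)
    have hfloor : F = fun x => ⌊v + g x - g (x + α)⌋₊ := by
      funext x
      rw [hF, Nat.floor_natCast]
    rw [hfloor]
    exact ((hg.const_add v).sub hgα).nat_floor
  have hFle (x : G) : F x ≤ ⌊v + 2 * B⌋₊ :=
    Nat.le_floor (by linarith [hF x, (abs_le.mp (hB x)).2, (abs_le.mp (hB (x + α))).1])
  let A : Fin ⌊v + 2 * B⌋₊ → Set G := fun i => {x | (i : ℕ) < F x}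
  have hA (i) : MeasurableSet (A i) := measurableSet_lt measurable_const hFmeas
  have hind (x : G) : multiIndicator A x = v + g x - g (x + α) :=
    (multiIndicator_superlevel (hFle x)).trans (hF x).symm
  have hvol : multiVolume μ A = v := by
    have hgint : Integrable g μ :=
      .of_bound hg.aestronglyMeasurable B (.of_forall hB)
    have hvg : Integrable (fun x => v + g x) μ := (integrable_const v).add hgint
    rw [← integral_multiIndicator μ hA]
    simp only [hind]
    rw [integral_sub hvg (hgint.comp_add_right α), integral_add (integrable_const v) hgint,
      integral_add_right_eq_self]
    simp
  refine ⟨_, A, ⟨hA, 2 * B + 1, ?_, .of_forall fun x N => ?_⟩, hvol.symm⟩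
  · linarith [(abs_nonneg _).trans (hB 0)]
  · have htelescope : ∑ n ∈ Finset.range N, multiIndicator A (x + n • α) - N * multiVolume μ A =
        g x - g (x + N • α) := by
      have := Finset.sum_range_sub' (fun n : ℕ => g (x + n • α)) N
      simp only [zero_smul, add_zero] at this
      rw [← this]
      simp [hind, hvol, succ_nsmul, add_assoc, add_sub_assoc, Finset.sum_add_distrib]
    rw [htelescope]
    linarith [abs_sub (g x) (g (x + N • α)), hB x, hB (x + N • α)]

theorem mem_brsVolumes_of_eigenfunction {θ : G → UnitAddCircle} (hθ : Measurable θ)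
    (hθα : ∀ x, θ (x + α) = θ x + v) (hv : 0 ≤ v) : v ∈ brsVolumes μ α := by
  let g : G → ℝ := fun x => AddCircle.equivIco 1 0 (θ x)
  have hg : Measurable g :=
    measurable_subtype_coe.comp ((AddCircle.measurableEquivIco 1 0).measurable.comp hθ)
  have hg0 (x : G) : 0 ≤ g x := (AddCircle.equivIco 1 0 (θ x)).2.1
  have hg1 (x : G) : g x < 1 := (AddCircle.equivIco 1 0 (θ x)).2.2.trans_eq (zero_add 1)
  have hgθ (x : G) : (g x : UnitAddCircle) = θ x := AddCircle.coe_equivIco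
  refine mem_brsVolumes_of_coboundary hg (B := 1)
    (fun x => (abs_of_nonneg (hg0 x)).trans_le (hg1 x).le) fun x => ?_
  obtain ⟨m, hm⟩ : ∃ m : ℤ, g x + v = g (x + α) + m := by
    rw [← coe_unitAddCircle_eq_coe_iff, AddCircle.coe_add, hgθ, hgθ, hθα]
  have hm0 : (-1 : ℝ) < m := by linarith [hg0 x, hg1 (x + α)]
  lift m to ℕ using Int.lt_iff_add_one_le.mp (by exact_mod_cast hm0)
  exact ⟨m, by rw [Int.cast_natCast] at hm; linarith⟩

end Rotation

/-! ### Eigenvalues of rotations of compact groups -/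

section Character

variable {G : Type*} [AddCommGroup G] [TopologicalSpace G]

/-- The character `x ↦ e^{2πi χ(x)}` attached to a homomorphism `χ` to `ℝ / ℤ`, as a continuous
complex function. -/
def complexCharacter (χ : G →ₜ+ UnitAddCircle) : C(G, ℂ) where
  toFun x := (χ x).toCircle
  continuous_toFun := continuous_subtype_val.comp
    (AddCircle.continuous_toCircle.comp (map_continuous χ))

theorem complexCharacter_apply (χ : G →ₜ+ UnitAddCircle) (x : G) :
    complexCharacter χ x = (χ x).toCircle := rfl

theorem complexCharacter_zero : complexCharacter (0 : G →ₜ+ UnitAddCircle) = 1 := by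
  ext x
  simp [complexCharacter_apply]

theorem complexCharacter_add (χ ψ : G →ₜ+ UnitAddCircle) :
    complexCharacter (χ + ψ) = complexCharacter χ * complexCharacter ψ := by
  ext x
  simp [complexCharacter_apply, AddCircle.toCircle_add]

theorem complexCharacter_neg (χ : G →ₜ+ UnitAddCircle) :
    complexCharacter (-χ) = star (complexCharacter χ) := by
  ext x
  change ((AddCircle.toCircle (-χ x) : Circle) : ℂ) = starRingEnd ℂ (AddCircle.toCircle (χ x))
  rw [AddCircle.toCircle_neg, Circle.coe_inv_eq_conj]

end Character

theorem eq_zero_of_integral_toCircle_ne_zero {G : Type*} [AddGroup G]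
    [MeasurableSpace G] [MeasurableAdd G] {μ : Measure G} [μ.IsAddRightInvariant] {α : G}
    {ψ : G → UnitAddCircle} {s : UnitAddCircle} (hψ : ∀ᵐ x ∂μ, ψ (x + α) = ψ x + s)
    (hne : ∫ x, ((ψ x).toCircle : ℂ) ∂μ ≠ 0) : s = 0 := by
  have hmul : (s.toCircle : ℂ) * ∫ x, ((ψ x).toCircle : ℂ) ∂μ =
      1 * ∫ x, ((ψ x).toCircle : ℂ) ∂μ := by
    calc (s.toCircle : ℂ) * ∫ x, ((ψ x).toCircle : ℂ) ∂μ
        = ∫ x, ((ψ (x + α)).toCircle : ℂ) ∂μ := by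
          rw [← integral_const_mul]
          refine integral_congr_ae (hψ.mono fun x hx => ?_)
          simp only [hx, AddCircle.toCircle_add, Circle.coe_mul, mul_comm]
      _ = 1 * ∫ x, ((ψ x).toCircle : ℂ) ∂μ := by
          rw [one_mul, integral_add_right_eq_self (fun x => ((ψ x).toCircle : ℂ))]
  refine AddCircle.injective_toCircle one_ne_zero (Circle.ext ?_)
  rw [mul_right_cancel₀ hne hmul, AddCircle.toCircle_zero, Circle.coe_one]

section CompactGroup

variable {G : Type*} [AddCommGroup G] [TopologicalSpace G] [IsTopologicalAddGroup G]
  [CompactSpace G] {D : AddSubgroup (G →ₜ+ UnitAddCircle)}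

theorem topologicalClosure_span_complexCharacter (hD : ∀ x, (∀ χ ∈ D, χ x = 0) → x = 0) :
    (Submodule.span ℂ (complexCharacter '' (D : Set (G →ₜ+ UnitAddCircle)))).topologicalClosure =
      ⊤ := by
  let S : Set C(G, ℂ) := complexCharacter '' D
  have hS_star : star S ⊆ S := by
    rintro f ⟨χ, hχ, hχf⟩
    exact ⟨-χ, D.neg_mem hχ, by rw [complexCharacter_neg, hχf, star_star]⟩
  have hS_monoid : (Submonoid.closure S : Set C(G, ℂ)) ⊆ S := fun f hf => by
    induction hf using Submonoid.closure_induction with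
    | mem _ hf => exact hf
    | one => exact ⟨0, D.zero_mem, complexCharacter_zero⟩
    | mul f g _ _ hf hg =>
      obtain ⟨⟨χ, hχ, rfl⟩, ψ, hψ, rfl⟩ := hf, hg
      exact ⟨χ + ψ, D.add_mem hχ hψ, complexCharacter_add χ ψ⟩
  have hadjoin : Subalgebra.toSubmodule (StarAlgebra.adjoin ℂ S).toSubalgebra =
      Submodule.span ℂ S := by
    rw [StarAlgebra.adjoin_toSubalgebra, Set.union_eq_self_of_subset_right hS_star]
    exact Algebra.adjoin_eq_span_of_subset _ (hS_monoid.trans Submodule.subset_span)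
  have hseparates : (StarAlgebra.adjoin ℂ S).toSubalgebra.SeparatesPoints := fun x y hxy => by
    obtain ⟨χ, hχ, hχxy⟩ : ∃ χ ∈ D, χ x ≠ χ y := by
      by_contra! h
      exact hxy (sub_eq_zero.mp (hD _ fun χ hχ => by rw [map_sub, h χ hχ, sub_self]))
    refine ⟨_, ⟨complexCharacter χ, StarAlgebra.subset_adjoin ℂ S ⟨χ, hχ, rfl⟩, rfl⟩, fun h => ?_⟩
    exact hχxy (AddCircle.injective_toCircle one_ne_zero (Circle.ext h))
  rw [← hadjoin]
  exact congr_arg (Subalgebra.toSubmodule <| StarSubalgebra.toSubalgebra ·)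
    (ContinuousMap.starSubalgebra_topologicalClosure_eq_top_of_separatesPoints _ hseparates)

variable [MeasurableSpace G] [BorelSpace G] {μ : Measure G}

theorem ae_eq_zero_of_integral_complexCharacter_mul [IsFiniteMeasure μ] [μ.WeaklyRegular]
    (hD : ∀ x, (∀ χ ∈ D, χ x = 0) → x = 0) {h : G → ℂ} (hh : MemLp h 2 μ)
    (horth : ∀ χ ∈ D, ∫ x, complexCharacter χ x * h x ∂μ = 0) : h =ᵐ[μ] 0 := by
  let T : C(G, ℂ) →L[ℂ] Lp ℂ 2 μ := ContinuousMap.toLp 2 μ ℂ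
  let K : Submodule ℂ (Lp ℂ 2 μ) :=
    Submodule.span ℂ (T '' (complexCharacter '' (D : Set (G →ₜ+ UnitAddCircle))))
  have hK : K.topologicalClosure = ⊤ := by
    have := (ContinuousMap.toLp_denseRange ℂ μ ℂ
      (ENNReal.ofNat_ne_top (n := 2))).topologicalClosure_map_submodule
        (topologicalClosure_span_complexCharacter hD)
    rwa [Submodule.map_span] at this
  have hinner : innerSL ℂ (hh.toLp h) = 0 := by
    refine ContinuousLinearMap.ext_on
      (Submodule.dense_iff_topologicalClosure_eq_top.mpr hK) ?_
    rintro - ⟨-, ⟨χ, hχ, rfl⟩, rfl⟩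
    change inner ℂ (hh.toLp h) (T (complexCharacter χ)) = 0
    rw [inner_eq_zero_symm, L2.inner_def, ← horth (-χ) (D.neg_mem hχ)]
    refine integral_congr_ae ?_
    filter_upwards [hh.coeFn_toLp, ContinuousMap.coeFn_toLp (p := 2) (𝕜 := ℂ) μ
      (complexCharacter χ)] with x hhx hχx
    rw [hhx, hχx, RCLike.inner_apply, complexCharacter_neg, mul_comm]
    rfl
  have hzero : hh.toLp h = 0 := inner_self_eq_zero.mp (DFunLike.congr_fun hinner (hh.toLp h))
  exact hh.coeFn_toLp.symm.trans (hzero ▸ Lp.coeFn_zero ℂ 2 μ)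

theorem exists_apply_eq_of_eigenfunction [IsProbabilityMeasure μ] [μ.WeaklyRegular]
    [μ.IsAddRightInvariant] (hD : ∀ x, (∀ χ ∈ D, χ x = 0) → x = 0) {α : G} {t : UnitAddCircle}
    {θ : G → UnitAddCircle} (hθ : Measurable θ) (hθα : ∀ᵐ x ∂μ, θ (x + α) = θ x + t) :
    ∃ χ ∈ D, χ α = t := by
  let h : G → ℂ := fun x => (θ x).toCircle
  have hh : MemLp h 2 μ := .of_bound
    ((continuous_subtype_val.comp AddCircle.continuous_toCircle).measurable.comp
      hθ).aestronglyMeasurable 1 (.of_forall fun x => (Circle.norm_coe _).le)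
  have hne : ¬ h =ᵐ[μ] 0 := fun h0 => by
    obtain ⟨x, hx⟩ := h0.exists
    exact Circle.coe_ne_zero _ hx
  obtain ⟨χ, hχ, hint⟩ : ∃ χ ∈ D, ∫ x, complexCharacter χ x * h x ∂μ ≠ 0 := by
    by_contra! horth
    exact hne (ae_eq_zero_of_integral_complexCharacter_mul hD hh horth)
  have hsum : χ α + t = 0 := by
    refine eq_zero_of_integral_toCircle_ne_zero (μ := μ) (α := α) (ψ := fun x => χ x + θ x) ?_ ?_
    · filter_upwards [hθα] with x hx
      rw [map_add, hx, add_add_add_comm]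
    · simpa only [AddCircle.toCircle_add, Circle.coe_mul, complexCharacter_apply, h] using hint
  exact ⟨-χ, D.neg_mem hχ, neg_eq_of_add_eq_zero_right hsum⟩

theorem mem_brsVolumes_iff_exists_character [IsProbabilityMeasure μ] [μ.WeaklyRegular]
    [μ.IsAddRightInvariant] (hD : ∀ x, (∀ χ ∈ D, χ x = 0) → x = 0) {α : G} {v : ℝ} :
    v ∈ brsVolumes μ α ↔ 0 ≤ v ∧ ∃ χ ∈ D, χ α = (v : UnitAddCircle) := by
  constructor
  · intro hv
    obtain ⟨θ, hθ, hθα⟩ := exists_eigenfunction_of_mem_brsVolumes hv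
    obtain ⟨k, A, -, rfl⟩ := hv
    exact ⟨multiVolume_nonneg μ A, exists_apply_eq_of_eigenfunction hD hθ hθα⟩
  · rintro ⟨hv, χ, -, hχα⟩
    exact mem_brsVolumes_of_eigenfunction (map_continuous χ).measurable
      (fun x => by rw [map_add, hχα]) hv

end CompactGroup

/-! ### Sums of `p`-adic fractional parts -/

theorem not_dvd_den_of_norm_le_one {p : ℕ} [Fact p.Prime] {r : ℚ} (hr : ‖(r : ℚ_[p])‖ ≤ 1) :
    ¬ p ∣ r.den := by
  rwa [Padic.norm_rat_le_one_iff_padicValuation_le_one, Rat.padicValuation_le_one_iff] at hr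

theorem finsum_sub_mem {ι M : Type*} [AddCommGroup M] {H : AddSubgroup M} {f : ι → M}
    (hf : f.support.Finite) (i : ι) (hH : ∀ j ≠ i, f j ∈ H) : ∑ᶠ j, f j - f i ∈ H := by
  classical
  have hsupport : f.support ⊆ (insert i hf.toFinset : Finset ι) := by simp
  rw [finsum_eq_sum_of_support_subset f hsupport,
    ← Finset.sum_erase_eq_sub (Finset.mem_insert_self i _)]
  exact H.sum_mem fun j hj => hH j (Finset.ne_of_mem_erase hj)

variable {Q : Set Nat.Primes}

theorem norm_le_one_of_mem_Gam {p : ℕ} [Fact p.Prime] (hp : ∀ q ∈ Q, (q : ℕ) ≠ p) {r : ℚ}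
    (hr : r ∈ Gam Q) : ‖(r : ℚ_[p])‖ ≤ 1 := by
  have hle : Gam Q ≤ (PadicInt.subring p).comap (Rat.castHom ℚ_[p]) := by
    refine Subring.closure_le.mpr ?_
    rintro - ⟨q, hq, rfl⟩
    have hcoprime : p.Coprime q := (Nat.coprime_primes Fact.out q.2).mpr (hp q hq).symm
    simp [PadicInt.mem_subring_iff, Padic.norm_natCast_eq_one_iff.mpr hcoprime]
  exact hle hr

theorem exists_int_eq_of_mem_Gam {r : ℚ} (hr : r ∈ Gam Q)
    (hint : ∀ p : Q, (r : ℚ_[(p : Nat.Primes)]) ∈ PadicInt.subring (p : Nat.Primes)) :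
    ∃ n : ℤ, r = n := by
  refine ⟨r.num, ((Rat.den_eq_one_iff r).mp ?_).symm⟩
  by_contra hden
  obtain ⟨p, hp, hdvd⟩ := Nat.exists_prime_and_dvd hden
  have : Fact p.Prime := ⟨hp⟩
  by_cases hpQ : ⟨p, hp⟩ ∈ Q
  · exact not_dvd_den_of_norm_le_one (hint ⟨⟨p, hp⟩, hpQ⟩) hdvd
  · refine not_dvd_den_of_norm_le_one (norm_le_one_of_mem_Gam (fun q hq hqp => hpQ ?_) hr) hdvd
    rwa [show (⟨p, hp⟩ : Nat.Primes) = q from Subtype.ext hqp.symm]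

/-- The sum `∑_{p ∈ Q} {x_p}_p` of the fractional parts of the components of an adele. -/
def fractSum (x : Adele Q) : ℚ := ∑ᶠ p : Q, padicFract (p : Nat.Primes) (x.2 p)

theorem fractSum_mem_Gam (x : Adele Q) : fractSum x ∈ Gam Q :=
  finsum_induction (· ∈ Gam Q) (zero_mem _) (fun _ _ => add_mem)
    fun p => padicFract_mem_Gam Q p _

theorem fractSum_eq_zero {x : Adele Q}
    (hx : ∀ p : Q, x.2 p ∈ PadicInt.subring (p : Nat.Primes)) : fractSum x = 0 :=
  finsum_eq_zero_of_forall_eq_zero fun p => padicFract_eq_zero _ (hx p)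

theorem sub_fractSum_mem_subring (x : Adele Q) (p : Q) :
    x.2 p - (fractSum x : ℚ_[(p : Nat.Primes)]) ∈ PadicInt.subring (p : Nat.Primes) := by
  have hfract : x.2 p - (padicFract (p : Nat.Primes) (x.2 p) : ℚ_[(p : Nat.Primes)]) ∈
      PadicInt.subring (p : Nat.Primes) := norm_sub_padicFract_le _ _
  have hrest : ((fractSum x - padicFract (p : Nat.Primes) (x.2 p) : ℚ) :
      ℚ_[(p : Nat.Primes)]) ∈ PadicInt.subring (p : Nat.Primes) :=
    finsum_sub_mem (H := ((PadicInt.subring (p : Nat.Primes)).comap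
      (Rat.castHom ℚ_[(p : Nat.Primes)])).toAddSubgroup) (finite_padicFract_ne_zero Q x) p
      fun q hq => norm_padicFract_le_of_ne Q hq (x.2 q)
  rw [Rat.cast_sub] at hrest
  simpa using sub_mem hfract hrest

theorem coe_fractSum_eq {x : Adele Q} {r : ℚ} (hr : r ∈ Gam Q)
    (hx : ∀ p : Q, x.2 p - (r : ℚ_[(p : Nat.Primes)]) ∈ PadicInt.subring (p : Nat.Primes)) :
    ((fractSum x : ℝ) : UnitAddCircle) = (r : ℝ) := by
  obtain ⟨n, hn⟩ := exists_int_eq_of_mem_Gam (sub_mem (fractSum_mem_Gam x) hr) fun p => by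
    simpa using sub_mem (hx p) (sub_fractSum_mem_subring x p)
  refine coe_unitAddCircle_eq_coe_iff.mpr ⟨n, ?_⟩
  exact_mod_cast sub_eq_iff_eq_add'.mp hn

theorem coe_fractSum_add (x y : Adele Q) :
    ((fractSum (x + y) : ℝ) : UnitAddCircle) = (fractSum x : ℝ) + (fractSum y : ℝ) := by
  rw [coe_fractSum_eq (add_mem (fractSum_mem_Gam x) (fractSum_mem_Gam y)) fun p => ?_,
    Rat.cast_add, AddCircle.coe_add]
  rw [Rat.cast_add, Prod.snd_add, RestrictedProduct.add_apply, add_sub_add_comm]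
  exact add_mem (sub_fractSum_mem_subring x p) (sub_fractSum_mem_subring y p)

theorem diag_fst (r : ℚ) : (diag Q r).1 = r := rfl

theorem diag_snd_apply (r : ℚ) (p : Q) : (diag Q r).2 p = (r : ℚ_[(p : Nat.Primes)]) := rfl

theorem coe_fractSum_diag {r : ℚ} (hr : r ∈ Gam Q) :
    ((fractSum (diag Q r) : ℝ) : UnitAddCircle) = (r : ℝ) :=
  coe_fractSum_eq hr fun p => by
    rw [diag_snd_apply, sub_self]
    exact zero_mem _

/-! ### Characters of the solenoid -/

theorem eventually_fractSum_eq_zero : ∀ᶠ x : Adele Q in 𝓝 0, fractSum x = 0 := by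
  have hopen : IsOpen {x : Adele Q | ∀ p : Q, x.2 p ∈ PadicInt.subring (p : Nat.Primes)} :=
    (isOpen_forall_mem (factIsOpen Q).out).preimage continuous_snd
  exact Filter.mem_of_superset (hopen.mem_nhds (x := 0) fun _ => zero_mem _)
    fun _ => fractSum_eq_zero

variable (Q) in
/-- The standard character `x ↦ -x_∞ + ∑_{p ∈ Q} {x_p}_p` of the adeles, with values in `ℝ / ℤ`. -/
def adeleCharacter : Adele Q →ₜ+ UnitAddCircle where
  toAddMonoidHom := AddMonoidHom.mk' (fun x => ((-x.1 + fractSum x : ℝ) : UnitAddCircle))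
    fun x y => by
      simp only [AddCircle.coe_add, coe_fractSum_add, Prod.fst_add, neg_add]
      abel
  continuous_toFun := by
    refine continuous_of_continuousAt_zero (AddMonoidHom.mk' _ _) ?_
    have hreal : Continuous fun x : Adele Q => ((-x.1 : ℝ) : UnitAddCircle) :=
      (AddCircle.continuous_mk' 1).comp continuous_fst.neg
    refine hreal.continuousAt.congr (eventually_fractSum_eq_zero.mono fun x hx => ?_)
    simp [hx]

theorem adeleCharacter_apply (x : Adele Q) :
    adeleCharacter Q x = ((-x.1 + fractSum x : ℝ) : UnitAddCircle) := rfl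

theorem adeleCharacter_diag {r : ℚ} (hr : r ∈ Gam Q) : adeleCharacter Q (diag Q r) = 0 := by
  rw [adeleCharacter_apply, AddCircle.coe_add, coe_fractSum_diag hr, ← AddCircle.coe_add, diag_fst,
    neg_add_cancel, AddCircle.coe_zero]

theorem exists_mem_Gam_of_adeleCharacter_eq_zero {x : Adele Q} (hx : adeleCharacter Q x = 0) :
    ∃ r ∈ Gam Q, x.1 = r ∧
      ∀ p : Q, x.2 p - (r : ℚ_[(p : Nat.Primes)]) ∈ PadicInt.subring (p : Nat.Primes) := by
  rw [adeleCharacter_apply, ← AddCircle.coe_zero] at hx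
  obtain ⟨n, hn⟩ := coe_unitAddCircle_eq_coe_iff.mp hx
  refine ⟨fractSum x - n, sub_mem (fractSum_mem_Gam x) (intCast_mem _ n), ?_, fun p => ?_⟩
  · push_cast
    linarith
  · rw [Rat.cast_sub, Rat.cast_intCast, sub_sub_eq_add_sub, add_sub_right_comm]
    exact add_mem (sub_fractSum_mem_subring x p) (intCast_mem _ n)

theorem eq_zero_of_forall_norm_pow_mul_le {K : Type*} [NormedField K] {c x : K} {B : ℝ}
    (hc : 1 < ‖c‖) (hx : ∀ k : ℕ, ‖c ^ k * x‖ ≤ B) : x = 0 := by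
  by_contra hne
  obtain ⟨k, hk⟩ := pow_unbounded_of_one_lt (B / ‖x‖) hc
  refine (hx k).not_gt ?_
  rwa [norm_mul, norm_pow, ← div_lt_iff₀ (norm_pos_iff.mpr hne)]

theorem eq_zero_of_adeleCharacter_eq_zero {x : Adele Q} (hx1 : x.1 = 0)
    (hx : ∀ γ ∈ Gam Q, adeleCharacter Q (diag Q γ * x) = 0) : x = 0 := by
  refine Prod.ext hx1 (RestrictedProduct.ext _ _ fun p => ?_)
  have hp : 1 < ‖(((p : Nat.Primes) : ℕ) : ℚ_[(p : Nat.Primes)])⁻¹‖ := by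
    rw [norm_inv, Padic.norm_p, inv_inv]
    exact_mod_cast p.1.2.one_lt
  refine eq_zero_of_forall_norm_pow_mul_le (B := 1) hp fun k => ?_
  have hγ : ((1 : ℚ) / ((p : Nat.Primes) : ℕ)) ^ k ∈ Gam Q :=
    (Gam Q).pow_mem (Subring.subset_closure ⟨p, p.2, rfl⟩) k
  obtain ⟨r, -, hr, hint⟩ := exists_mem_Gam_of_adeleCharacter_eq_zero (hx _ hγ)
  have hr0 : r = 0 := by
    rw [Prod.fst_mul, hx1, mul_zero] at hr
    exact_mod_cast hr.symm
  have hk := hint p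
  rw [hr0, Rat.cast_zero, sub_zero, Prod.snd_mul, RestrictedProduct.mul_apply, diag_snd_apply,
    PadicInt.mem_subring_iff] at hk
  simpa using hk

variable (Q) in
/-- The characters `x ↦ -γ x_∞ + ∑_{p ∈ Q} {γ x_p}_p` of the solenoid, indexed by `γ ∈ Γ_Q`. -/
def solenoidCharacter : Gam Q →+ (Solenoid Q →ₜ+ UnitAddCircle) where
  toFun γ :=
    { QuotientAddGroup.lift (lattice Q)
        ((adeleCharacter Q).toAddMonoidHom.comp (AddMonoidHom.mulLeft (diag Q γ))) <| by
          rintro - ⟨r, hr, rfl⟩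
          change adeleCharacter Q (diag Q γ * diag Q r) = 0
          rw [← map_mul, adeleCharacter_diag (mul_mem γ.2 hr)] with
      continuous_toFun := continuous_quot_lift _
        ((map_continuous (adeleCharacter Q)).comp (continuous_const_mul (diag Q γ))) }
  map_zero' := by
    ext x
    obtain ⟨x, rfl⟩ := QuotientAddGroup.mk'_surjective (lattice Q) x
    change adeleCharacter Q (diag Q 0 * x) = 0
    rw [map_zero, zero_mul, map_zero]
  map_add' γ δ := by
    ext x
    obtain ⟨x, rfl⟩ := QuotientAddGroup.mk'_surjective (lattice Q) x
    change adeleCharacter Q (diag Q (γ + δ) * x) =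
      adeleCharacter Q (diag Q γ * x) + adeleCharacter Q (diag Q δ * x)
    rw [map_add, add_mul, map_add]

theorem solenoidCharacter_proj (γ : Gam Q) (x : Adele Q) :
    solenoidCharacter Q γ (proj Q x) = adeleCharacter Q (diag Q γ * x) := rfl

theorem solenoidCharacter_proj_eq_coe (γ : Gam Q) (x : Adele Q) :
    solenoidCharacter Q γ (proj Q x) = ((-((γ : ℚ) * x.1) + ∑ᶠ p : Q, (padicFract
      (p : Nat.Primes) ((γ : ℚ) * x.2 p) : ℝ) : ℝ) : UnitAddCircle) := by
  rw [solenoidCharacter_proj, adeleCharacter_apply, fractSum]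
  congr 2
  exact (Rat.castHom ℝ).toAddMonoidHom.map_finsum (finite_padicFract_ne_zero Q (diag Q γ * x))

theorem eq_zero_of_forall_solenoidCharacter_eq_zero {y : Solenoid Q}
    (hy : ∀ γ, solenoidCharacter Q γ y = 0) : y = 0 := by
  obtain ⟨x, rfl⟩ : ∃ x, proj Q x = y := QuotientAddGroup.mk'_surjective (lattice Q) y
  have hx1 : adeleCharacter Q x = 0 := by
    simpa only [solenoidCharacter_proj, Subring.coe_one, map_one, one_mul] using hy 1
  obtain ⟨r, hr, hr1, -⟩ := exists_mem_Gam_of_adeleCharacter_eq_zero hx1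
  have hx : x - diag Q r = 0 := by
    refine eq_zero_of_adeleCharacter_eq_zero (sub_eq_zero.mpr hr1) fun γ hγ => ?_
    rw [mul_sub, map_sub, ← map_mul, adeleCharacter_diag (mul_mem hγ hr), sub_zero]
    exact hy ⟨γ, hγ⟩
  exact (QuotientAddGroup.eq_zero_iff x).mpr ⟨r, hr, (sub_eq_zero.mp hx).symm⟩

instance (Q : Set Nat.Primes) : (haar Q).Regular :=
  inferInstanceAs
    (Measure.addHaarMeasure (⊤ : TopologicalSpace.PositiveCompacts (Solenoid Q))).Regular

end AdelicBRS

end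

theorem theorem1p2_general (Q : Set Nat.Primes) (α : AdelicBRS.Adele Q) :
    AdelicBRS.brsVolumes (AdelicBRS.haar Q) (AdelicBRS.proj Q α) =
      {v : ℝ | 0 ≤ v ∧ ∃ γ ∈ AdelicBRS.Gam Q, ∃ n : ℤ,
        v = -((γ : ℝ) * α.1)
          + ∑ᶠ p : Q, (AdelicBRS.padicFract (p : Nat.Primes)
              ((γ : ℚ_[(p : Nat.Primes)]) * α.2 p) : ℝ)
          + (n : ℝ)} := by
  have hseparates (x : AdelicBRS.Solenoid Q)
      (hx : ∀ χ ∈ (AdelicBRS.solenoidCharacter Q).range, χ x = 0) : x = 0 :=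
    AdelicBRS.eq_zero_of_forall_solenoidCharacter_eq_zero fun γ => hx _ ⟨γ, rfl⟩
  ext v
  rw [AdelicBRS.mem_brsVolumes_iff_exists_character hseparates, Set.mem_ofPred_eq]
  refine and_congr_right fun _ => ?_
  constructor
  · rintro ⟨-, ⟨γ, rfl⟩, hγ⟩
    rw [AdelicBRS.solenoidCharacter_proj_eq_coe, eq_comm,
      AdelicBRS.coe_unitAddCircle_eq_coe_iff] at hγ
    exact ⟨γ, γ.2, hγ⟩
  · rintro ⟨γ, hγ, hv⟩
    refine ⟨_, ⟨⟨γ, hγ⟩, rfl⟩, ?_⟩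
    rw [AdelicBRS.solenoidCharacter_proj_eq_coe, eq_comm]
    exact AdelicBRS.coe_unitAddCircle_eq_coe_iff.mpr hv

theorem theorem1p2 (Q : Set Nat.Primes) (α : AdelicBRS.Adele Q) (hα : Irrational α.1) :
    AdelicBRS.brsVolumes (AdelicBRS.haar Q) (AdelicBRS.proj Q α) =
      {v : ℝ | 0 ≤ v ∧ ∃ γ ∈ AdelicBRS.Gam Q, ∃ n : ℤ,
        v = -((γ : ℝ) * α.1)
          + ∑ᶠ p : Q, (AdelicBRS.padicFract (p : Nat.Primes)
              ((γ : ℚ_[(p : Nat.Primes)]) * α.2 p) : ℝ)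
          + (n : ℝ)} :=
  theorem1p2_general Q α
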